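/- Let $n\in\mathbb{N}$, $A\in M_n(\mathbb{C})$, and let $L$ be a limit of complex roots of $A$: there are a strictly increasing sequence $(c_i)$ of positive integers and matrices $B_i\in M_n(\mathbb{C})$ with $B_i^{c_i}=A$ for all $i$ and $\lim_{i\to\infty}B_i=L$. For a matrix $X\in M_n(\mathbb{C})$ let $\sigma_*(X)$ be the set of its distinct nonzero eigenvalues, $\operatorname{mult}(\lambda,X)$ the algebraic multiplicity of $\lambda$ as an eigenvalue of $X$, and $\mathcal E(\lambda,X)$ the generalised eigenspace of $X$ for $\lambda$. Let $M$ be the multiplicity rearrangement matrix for $(A,L)$, i.e. the matrix with rows indexed by $\sigma_*(A)$, columns indexed by $\sigma_*(L)$ and entries $$M[\lambda,\nu]=\dim\bigl(\mathcal E(\lambda,A)\cap\mathcal E(\nu,L)\bigr).$$ Then: 1. For every $\lambda\in\sigma_*(A)$, the multiset of the sizes of the Jordan blocks with eigenvalue $\lambda$ in the Jordan canonical form of $A$ (which exists) can be partitioned into (possibly empty) multisets $\mathcal B(\lambda,\nu)$, $\nu\in\sigma_*(L)$, such that for every $\nu\in\sigma_*(L)$ the entry $M[\lambda,\nu]$ is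 the sum of the elements of $\mathcal B(\lambda,\nu)$ (the empty sum being $0$). In particular, $\sum_{\nu\in\sigma_*(L)}M[\lambda,\nu]=\operatorname{mult}(\lambda,A)$. 2. For every $\nu\in\sigma_*(L)$, $\sum_{\lambda\in\sigma_*(A)}M[\lambda,\nu]=\operatorname{mult}(\nu,L)$. 3. For every $\lambda\in\sigma_*(A)$, $$\mathcal E(\lambda,A)\subseteq\operatorname{span}\{\mathcal E(\nu,L):\nu\in\sigma_*(L),\ M[\lambda,\nu]\neq0\},$$ with equality if $\operatorname{mult}(\nu,L)=M[\lambda,\nu]$ for all $\nu\in\sigma_*(L)$ with $M[\lambda,\nu]\neq0$. 4. For every $\nu\in\sigma_*(L)$, $$\mathcal E(\nu,L)\subseteq\operatorname{span}\{\mathcal E(\lambda,A):\lambda\in\sigma_*(A),\ M[\lambda,\nu]\neq0\},$$ with equality if $\operatorname{mult}(\lambda,A)=M[\lambda,\nu]$ for all $\lambda\in\sigma_*(A)$ with $M[\lambda,\nu]\neq0$. -/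

import Mathlib

open Filter Topology

/-- The limits of `S`-roots of `A`: the limits `L` of convergent sequences `B i ∈ S` such that
`(B i) ^ (c i) = A` for a strictly increasing sequence of positive integers `c i`.
(Convergence of matrices is entrywise.) -/
def limitsOfRoots {n : ℕ} (S : Set (Matrix (Fin n) (Fin n) ℂ)) (A : Matrix (Fin n) (Fin n) ℂ) :
    Set (Matrix (Fin n) (Fin n) ℂ) :=
  {L | ∃ (c : ℕ → ℕ) (B : ℕ → Matrix (Fin n) (Fin n) ℂ), StrictMono c ∧
    (∀ i, 0 < c i ∧ B i ∈ S ∧ B i ^ c i = A) ∧ Tendsto B atTop (𝓝 L)}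

/-- The limits of complex roots of `A`. -/
def limitsOfComplexRoots {n : ℕ} (A : Matrix (Fin n) (Fin n) ℂ) :
    Set (Matrix (Fin n) (Fin n) ℂ) :=
  limitsOfRoots Set.univ A

/-- The finite set of distinct nonzero eigenvalues of `A`. -/
noncomputable def nonzeroEigenvalues {n : ℕ} (A : Matrix (Fin n) (Fin n) ℂ) : Finset ℂ :=
  A.charpoly.roots.toFinset.erase 0

theorem mem_nonzeroEigenvalues_iff {n : ℕ} (A : Matrix (Fin n) (Fin n) ℂ) (z : ℂ) :
    z ∈ nonzeroEigenvalues A ↔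
      z ≠ 0 ∧ Module.End.HasEigenvalue (Matrix.toLin' A) z := by
  have h : A.charpoly ≠ 0 := A.charpoly_monic.ne_zero
  rw [nonzeroEigenvalues, Finset.mem_erase, Multiset.mem_toFinset, Polynomial.mem_roots h,
    ← Matrix.mem_spectrum_iff_isRoot_charpoly, Module.End.hasEigenvalue_iff_mem_spectrum,
    Matrix.spectrum_toLin']

/-- The algebraic multiplicity of `z` as an eigenvalue of `A`. -/
noncomputable def algMult {n : ℕ} (z : ℂ) (A : Matrix (Fin n) (Fin n) ℂ) : ℕ :=
  A.charpoly.rootMultiplicity z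

/-- The generalised eigenspace of `A` for `z`: all `v` with `(A - z I) ^ k v = 0` for some `k`. -/
noncomputable def genEigSpace {n : ℕ} (z : ℂ) (A : Matrix (Fin n) (Fin n) ℂ) :
    Submodule ℂ (Fin n → ℂ) :=
  Module.End.maxGenEigenspace (Matrix.toLin' A) z

/-- The upper triangular `m × m` Jordan block with eigenvalue `z`. -/
def jordanBlock (m : ℕ) (z : ℂ) : Matrix (Fin m) (Fin m) ℂ :=
  Matrix.of fun i j => if i = j then z else if (i : ℕ) + 1 = (j : ℕ) then 1 else 0

/-- `Z⁻¹ A Z = J_{m 0}(e 0) ⊕ ⋯ ⊕ J_{m (k-1)}(e (k-1))` for some invertible `Z`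
(with inverse `W`), where all the block sizes `m i` are positive: the right-hand side is a Jordan
canonical form of `A`. -/
def IsJordanForm {n : ℕ} (A : Matrix (Fin n) (Fin n) ℂ) {k : ℕ} (m : Fin k → ℕ)
    (e : Fin k → ℂ) : Prop :=
  (∀ i, 0 < m i) ∧
  ∃ (Z : Matrix (Fin n) ((i : Fin k) × Fin (m i)) ℂ)
    (W : Matrix ((i : Fin k) × Fin (m i)) (Fin n) ℂ),
    Z * W = 1 ∧ W * Z = 1 ∧
      W * A * Z = Matrix.blockDiagonal' fun i => jordanBlock (m i) (e i)

/-- `s` is the multiset of the sizes of the blocks with eigenvalue `z` in a Jordan canonical form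
of `A`. -/
def IsJordanBlockSizes {n : ℕ} (z : ℂ) (A : Matrix (Fin n) (Fin n) ℂ) (s : Multiset ℕ) : Prop :=
  ∃ (k : ℕ) (m : Fin k → ℕ) (e : Fin k → ℂ), IsJordanForm A m e ∧
    s = (Finset.univ.filter fun i => e i = z).val.map m

/-- The multiplicity rearrangement matrix for `(A, L)`. -/
noncomputable def multRearrangement {n : ℕ} (A L : Matrix (Fin n) (Fin n) ℂ) :
    Matrix (nonzeroEigenvalues A) (nonzeroEigenvalues L) ℕ :=
  Matrix.of fun lam nu =>
    Module.finrank ℂ (genEigSpace (lam : ℂ) A ⊓ genEigSpace (nu : ℂ) L : Submodule ℂ (Fin n → ℂ))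

/-!
# Rearrangement of multiplicities under limits of roots

Let `B i ^ c i = A` with `B i → L`. Two facts about the pair `(A, L)` carry everything.

* `L` commutes with `A`, because every `B i` does.
* The generalised eigenspaces for `0` agree (`genEigSpace_zero_of_mem_limitsOfComplexRoots`). The
  kernels of `A ^ n` and `B i ^ n` coincide, and the limit gives one inclusion. For the other, let
  `P` be the projection onto the invertible part of `A` along the nilpotent part. It commutes with
  `B i`, so `(B i * P + (1 - P)) ^ c i = A * P + (1 - P)` and the determinants of
  `B i * P + (1 - P)` are `c i`-th roots of a fixed nonzero number; their limit
  `det (L * P + (1 - P))` is therefore nonzero, and `L` is injective on the invertible part.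

Hence every `L`-invariant subspace `p` of a generalised eigenspace of `A` for a nonzero eigenvalue is
the direct sum of the intersections `p ⊓ genEigSpace ν L` over the *nonzero* eigenvalues `ν` of `L`
(`finrank_eq_sum_inf_genEigSpace`). Taking for `p` the full generalised eigenspace gives the row sums
and the inclusions between spans; the hypotheses are symmetric in `A` and `L`, which gives the column
sums and the reverse inclusions.

For the Jordan blocks, take for `P ν` the block sizes at `λ` of the restriction of `A` to
`genEigSpace ν L`. Applying the decomposition to `p = ker (A - λ) ^ l` shows that the union of the
`P ν` and any system `s` of block sizes of `A` at `λ` have the same truncated sums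
`∑ min (a, l) = dim ker (A - λ) ^ l` for all `l`, and these determine a multiset of positive numbers
(`Multiset.eq_of_sum_map_min_eq`). The Jordan form itself comes from the structure theorem for finitely
generated torsion modules over `ℂ[X]` (`exists_isJordanBasis_of_fintype`).
-/

/-! ### Limits of roots -/

theorem mul_add_one_sub_pow_of_commute {R : Type*} [Ring R] {P X : R} (hP : IsIdempotentElem P)
    (h : Commute X P) (c : ℕ) : (X * P + (1 - P)) ^ c = X ^ c * P + (1 - P) := by
  induction c with
  | zero => simp
  | succ c ih =>
    have h1 : (1 - P) * (X * P) = 0 := by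
      rw [h.eq, ← mul_assoc, hP.one_sub_mul_self, zero_mul]
    have h2 : P * (X * P) = X * P := by rw [h.eq, ← mul_assoc, hP.eq]
    rw [pow_succ, ih, add_mul, mul_add, mul_add, h1, mul_assoc (X ^ c) P (1 - P),
      hP.mul_one_sub_self, hP.one_sub.eq, mul_assoc, h2, pow_succ]
    simp [mul_assoc]

/-- The Fitting decomposition of `A` as a matrix: `P` projects onto the part on which `A` is invertible,
along the part on which `A` is nilpotent. The last clause expresses that `A` is invertible on the
range of `P`. -/
theorem exists_idempotent_fitting {n : ℕ} (A : Matrix (Fin n) (Fin n) ℂ) :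
    ∃ P : Matrix (Fin n) (Fin n) ℂ, IsIdempotentElem P ∧ (∀ X, Commute X A → Commute X P) ∧
      (∀ v, P.mulVec v = 0 → v ∈ genEigSpace 0 A) ∧ IsUnit (A * P + (1 - P)) := by
  set f := Matrix.toLin' A with hf
  obtain ⟨N, hN⟩ := f.eventually_isCompl_ker_pow_range_pow.exists_forall_of_atTop
  specialize hN (N + 1) (Nat.le_succ N)
  set p := (LinearMap.range (f ^ (N + 1))).projection (LinearMap.ker (f ^ (N + 1))) hN.symm with hp
  have hrange : LinearMap.range p = LinearMap.range (f ^ (N + 1)) :=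
    Submodule.range_projection hN.symm
  have hker : LinearMap.ker p = LinearMap.ker (f ^ (N + 1)) := Submodule.ker_projection hN.symm
  have hid : IsIdempotentElem p := Submodule.isIdempotentElem_projection hN.symm
  have hlin : Matrix.toLin' (LinearMap.toMatrix' p) = p := Matrix.toLin'_toMatrix' p
  have hcomm : ∀ X, Commute X A → Commute X (LinearMap.toMatrix' p) := by
    intro X hX
    have h0 : Commute (Matrix.toLin' X) (f ^ (N + 1)) := by
      refine Commute.pow_right ?_ _
      rw [hf, Commute, SemiconjBy, Module.End.mul_eq_comp, Module.End.mul_eq_comp,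
        ← Matrix.toLin'_mul, ← Matrix.toLin'_mul, hX.eq]
    have h1 : Commute p (Matrix.toLin' X) := by
      rw [LinearMap.IsIdempotentElem.commute_iff hid, hrange, hker]
      constructor
      · rintro _ ⟨y, rfl⟩
        exact ⟨Matrix.toLin' X y, (LinearMap.congr_fun h0.eq y).symm⟩
      · intro y hy
        rw [LinearMap.mem_ker] at hy
        have := LinearMap.congr_fun h0.eq y
        simp only [Module.End.mul_apply, hy, map_zero] at this
        exact this.symm
    apply Matrix.toLin'.injective
    rw [Matrix.toLin'_mul, Matrix.toLin'_mul, hlin]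
    exact h1.eq.symm
  have hkerP : ∀ v, (LinearMap.toMatrix' p).mulVec v = 0 → f ((f ^ N) v) = 0 := by
    intro v hv
    rw [← Matrix.toLin'_apply, hlin, ← LinearMap.mem_ker, hker, LinearMap.mem_ker,
      pow_succ'] at hv
    exact hv
  have hidP : IsIdempotentElem (LinearMap.toMatrix' p) := by
    rw [IsIdempotentElem, ← LinearMap.toMatrix'_mul, hid.eq]
  refine ⟨LinearMap.toMatrix' p, hidP, hcomm, ?_, ?_⟩
  · intro v hv
    rw [genEigSpace, Module.End.mem_maxGenEigenspace]
    refine ⟨N + 1, ?_⟩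
    rw [zero_smul, sub_zero, pow_succ']
    exact hkerP v hv
  · set P := LinearMap.toMatrix' p
    rw [← Matrix.mulVec_injective_iff_isUnit, ← Matrix.coe_mulVecLin,
      ← LinearMap.ker_eq_bot, LinearMap.ker_eq_bot']
    intro v hv
    rw [Matrix.mulVecLin_apply] at hv
    have hAP := (hcomm A (Commute.refl A)).eq
    have h1 : (A * P).mulVec v = 0 := by
      have := congrArg P.mulVec hv
      rw [Matrix.mulVec_mulVec, mul_add, hidP.mul_one_sub_self, add_zero, hAP, ← mul_assoc,
        hidP.eq, Matrix.mulVec_zero] at this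
      rwa [hAP]
    have h2 : v = P.mulVec v := by
      rw [Matrix.add_mulVec, h1, zero_add, Matrix.sub_mulVec, Matrix.one_mulVec] at hv
      exact sub_eq_zero.mp hv
    have h3 : f v = 0 := by
      rw [← Matrix.mulVec_mulVec, ← h2] at h1
      rwa [hf, Matrix.toLin'_apply]
    have h4 : v ∈ LinearMap.ker p := by
      rw [hker, LinearMap.mem_ker, pow_succ, Module.End.mul_apply, h3, map_zero]
    rw [h2, ← Matrix.toLin'_apply, hlin]
    exact h4

theorem commute_of_mem_limitsOfComplexRoots {n : ℕ} {A L : Matrix (Fin n) (Fin n) ℂ}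
    (hL : L ∈ limitsOfComplexRoots A) : Commute L A := by
  obtain ⟨c, B, -, hB, hlim⟩ := hL
  refine tendsto_nhds_unique (hlim.mul_const A) ((hlim.const_mul A).congr fun i => ?_)
  rw [← (hB i).2.2]
  exact (Commute.pow_self (B i) (c i)).eq

/-- A vector killed by a power of `A` is killed by `B i ^ n` for every root `B i` of `A`, with an exponent
that does not depend on `i`, and hence by `L ^ n`. -/
theorem genEigSpace_zero_le_of_mem_limitsOfComplexRoots {n : ℕ} {A L : Matrix (Fin n) (Fin n) ℂ}
    (hL : L ∈ limitsOfComplexRoots A) : genEigSpace 0 A ≤ genEigSpace 0 L := by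
  obtain ⟨c, B, -, hB, hlim⟩ := hL
  intro v hv
  rw [genEigSpace, Module.End.mem_maxGenEigenspace] at hv ⊢
  obtain ⟨k, hk⟩ := hv
  simp only [zero_smul, sub_zero, ← Matrix.toLin'_pow, Matrix.toLin'_apply] at hk ⊢
  have hBn : ∀ i, (B i ^ n).mulVec v = 0 := by
    intro i
    have h1 : v ∈ Module.End.maxGenEigenspace (Matrix.toLin' (B i)) 0 := by
      rw [Module.End.mem_maxGenEigenspace]
      refine ⟨c i * k, ?_⟩
      rw [zero_smul, sub_zero, ← Matrix.toLin'_pow, Matrix.toLin'_apply, pow_mul, (hB i).2.2, hk]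
    rw [Module.End.maxGenEigenspace_eq_genEigenspace_finrank, Module.End.mem_genEigenspace_nat,
      zero_smul, sub_zero, ← Matrix.toLin'_pow, LinearMap.mem_ker, Module.finrank_fin_fun,
      Matrix.toLin'_apply] at h1
    exact h1
  refine ⟨n, ?_⟩
  have hcont : Continuous fun X : Matrix (Fin n) (Fin n) ℂ => (X ^ n).mulVec v :=
    (continuous_pow n).matrix_mulVec continuous_const
  refine tendsto_nhds_unique ((hcont.tendsto L).comp hlim) ?_
  simp only [Function.comp_def, hBn]
  exact tendsto_const_nhds

/-- If `‖x i‖` were eventually at most `1 / 2`, then `x i ^ c i` would tend to `0`. -/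
theorem limit_ne_zero_of_pow_eq {c : ℕ → ℕ} (hc : StrictMono c) {x : ℕ → ℂ} {a y : ℂ} (ha : a ≠ 0)
    (hx : ∀ i, x i ^ c i = a) (hlim : Tendsto x atTop (𝓝 y)) : y ≠ 0 := by
  rintro rfl
  have h1 : ∀ᶠ i in atTop, ‖x i‖ < 1 / 2 :=
    (hlim.norm.eventually_lt_const (by simp : ‖(0 : ℂ)‖ < 1 / 2))
  have h2 : Tendsto (fun i => ((1 : ℝ) / 2) ^ c i) atTop (𝓝 0) :=
    (tendsto_pow_atTop_nhds_zero_of_lt_one (by norm_num) (by norm_num)).comp hc.tendsto_atTop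
  have h3 : ‖a‖ ≤ 0 := by
    refine ge_of_tendsto h2 (h1.mono fun i hi => ?_)
    rw [← hx i, norm_pow]
    exact pow_le_pow_left₀ (norm_nonneg _) hi.le _
  exact ha (norm_le_zero_iff.mp h3)

theorem genEigSpace_zero_of_mem_limitsOfComplexRoots {n : ℕ} {A L : Matrix (Fin n) (Fin n) ℂ}
    (hL : L ∈ limitsOfComplexRoots A) : genEigSpace 0 A = genEigSpace 0 L := by
  refine le_antisymm (genEigSpace_zero_le_of_mem_limitsOfComplexRoots hL) ?_
  obtain ⟨P, hid, hcomm, hker, hunit⟩ := exists_idempotent_fitting A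
  have hLP : Commute L P := hcomm L (commute_of_mem_limitsOfComplexRoots hL)
  obtain ⟨c, B, hc, hB, hlim⟩ := hL
  have hdet : (L * P + (1 - P)).det ≠ 0 := by
    have hcont : Continuous fun X : Matrix (Fin n) (Fin n) ℂ => (X * P + (1 - P)).det :=
      ((continuous_id.matrix_mul continuous_const).add continuous_const).matrix_det
    refine limit_ne_zero_of_pow_eq hc (a := (A * P + (1 - P)).det) ?_ (fun i => ?_)
      ((hcont.tendsto L).comp hlim)
    · exact ((Matrix.isUnit_iff_isUnit_det _).mp hunit).ne_zero
    · have hBA : Commute (B i) A := (hB i).2.2 ▸ Commute.self_pow (B i) (c i)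
      simp only [Function.comp_apply]
      rw [← Matrix.det_pow, mul_add_one_sub_pow_of_commute hid (hcomm _ hBA), (hB i).2.2]
  intro v hv
  rw [genEigSpace, Module.End.mem_maxGenEigenspace] at hv
  obtain ⟨k, hk⟩ := hv
  rw [zero_smul, sub_zero, ← Matrix.toLin'_pow, Matrix.toLin'_apply] at hk
  refine hker v (Matrix.eq_zero_of_mulVec_eq_zero
    (M := (L * P + (1 - P)) ^ k) (by rw [Matrix.det_pow]; exact pow_ne_zero k hdet) ?_)
  rw [mul_add_one_sub_pow_of_commute hid hLP, Matrix.mulVec_mulVec, add_mul,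
    hid.one_sub_mul_self, add_zero, mul_assoc, hid.eq, (hLP.pow_left k).eq,
    ← Matrix.mulVec_mulVec, hk, Matrix.mulVec_zero]

/-! ### Generalised eigenspaces of commuting endomorphisms -/

section Commuting

open Module

variable {V : Type*} [AddCommGroup V] [Module ℂ V] [FiniteDimensional ℂ V]

theorem finrank_finset_sup_of_supIndep {ι : Type*} {s : Finset ι} {W : ι → Submodule ℂ V}
    (h : s.SupIndep W) : finrank ℂ (s.sup W : Submodule ℂ V) = ∑ i ∈ s, finrank ℂ (W i) := by
  classical
  induction s using Finset.induction_on with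
  | empty => simp
  | insert a s ha ih =>
    have hdisj : Disjoint (W a) (s.sup W) :=
      h (Finset.subset_insert a s) (Finset.mem_insert_self a s) ha
    have := Submodule.finrank_sup_add_finrank_inf_eq (W a) (s.sup W)
    rw [hdisj.eq_bot, finrank_bot, add_zero] at this
    rw [Finset.sup_insert, this, Finset.sum_insert ha, ih (h.subset (Finset.subset_insert a s))]

theorem eq_finset_sup_inf_maxGenEigenspace {p : Submodule ℂ V} {g : End ℂ V}
    (hp : ∀ x ∈ p, g x ∈ p) (S : Finset ℂ) (hS : ∀ z ∉ S, p ⊓ g.maxGenEigenspace z = ⊥) :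
    p = S.sup fun z => p ⊓ g.maxGenEigenspace z := by
  conv_lhs => rw [Submodule.eq_iSup_inf_genEigenspace ⊤ hp g.iSup_maxGenEigenspace_eq_top]
  refine le_antisymm (iSup_le fun z => ?_) (Finset.sup_le fun z _ => ?_)
  · by_cases hz : z ∈ S
    · exact Finset.le_sup (f := fun z => p ⊓ g.maxGenEigenspace z) hz
    · exact (hS z hz).le.trans bot_le
  · exact le_iSup (fun z => p ⊓ g.maxGenEigenspace z) z

theorem finrank_eq_sum_finrank_inf_maxGenEigenspace {p : Submodule ℂ V} {g : End ℂ V}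
    (hp : ∀ x ∈ p, g x ∈ p) (S : Finset ℂ) (hS : ∀ z ∉ S, p ⊓ g.maxGenEigenspace z = ⊥) :
    finrank ℂ p = ∑ z ∈ S, finrank ℂ (p ⊓ g.maxGenEigenspace z : Submodule ℂ V) := by
  conv_lhs => rw [eq_finset_sup_inf_maxGenEigenspace hp S hS]
  refine finrank_finset_sup_of_supIndep ?_
  exact (g.independent_maxGenEigenspace.supIndep' S).antitone_fun fun _ _ => inf_le_right

end Commuting

/-! ### Commuting matrices with the same nilpotent part -/

open Module in
theorem finrank_genEigSpace {n : ℕ} (z : ℂ) (A : Matrix (Fin n) (Fin n) ℂ) :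
    finrank ℂ (genEigSpace z A) = algMult z A := by
  rw [genEigSpace, LinearMap.finrank_maxGenEigenspace_eq, algMult, Matrix.charpoly_toLin']

theorem genEigSpace_eq_bot {n : ℕ} {z : ℂ} {A : Matrix (Fin n) (Fin n) ℂ} (hz : z ≠ 0)
    (h : z ∉ nonzeroEigenvalues A) : genEigSpace z A = ⊥ := by
  rw [← Submodule.finrank_eq_zero, finrank_genEigSpace, algMult, ← Polynomial.count_roots,
    Multiset.count_eq_zero]
  simpa [nonzeroEigenvalues, hz] using h

theorem genEigSpace_inf_eq_bot {n : ℕ} {A L : Matrix (Fin n) (Fin n) ℂ}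
    (h0 : genEigSpace 0 A = genEigSpace 0 L) {lam z : ℂ} (hlam : lam ≠ 0)
    (hz : z ∉ nonzeroEigenvalues L) : genEigSpace lam A ⊓ genEigSpace z L = ⊥ := by
  by_cases h : z = 0
  · rw [h, ← h0]
    exact (Module.End.disjoint_genEigenspace (Matrix.toLin' A) hlam ⊤ ⊤).eq_bot
  · rw [genEigSpace_eq_bot h hz, inf_bot_eq]

theorem genEigSpace_invariant {n : ℕ} {A L : Matrix (Fin n) (Fin n) ℂ} (h : Commute L A) (z : ℂ) :
    ∀ x ∈ genEigSpace z A, Matrix.toLin' L x ∈ genEigSpace z A :=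
  Module.End.mapsTo_maxGenEigenspace_of_comm (h.symm.map Matrix.toLinAlgEquiv') z

/-- Since the zero parts of `A` and `L` agree, an `L`-invariant subspace of a generalised eigenspace
of `A` for a nonzero eigenvalue only meets the generalised eigenspaces of `L` for nonzero
eigenvalues, and is decomposed by them. -/
theorem finrank_eq_sum_inf_genEigSpace {n : ℕ} {A L : Matrix (Fin n) (Fin n) ℂ}
    (h0 : genEigSpace 0 A = genEigSpace 0 L) {lam : ℂ} (hlam : lam ≠ 0)
    {p : Submodule ℂ (Fin n → ℂ)} (hp : ∀ x ∈ p, Matrix.toLin' L x ∈ p)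
    (hpA : p ≤ genEigSpace lam A) :
    Module.finrank ℂ p = ∑ nu : nonzeroEigenvalues L,
      Module.finrank ℂ (p ⊓ genEigSpace (nu : ℂ) L : Submodule ℂ (Fin n → ℂ)) := by
  rw [finrank_eq_sum_finrank_inf_maxGenEigenspace hp (nonzeroEigenvalues L) fun z hz =>
    le_bot_iff.mp ((inf_le_inf_right _ hpA).trans (genEigSpace_inf_eq_bot h0 hlam hz).le)]
  exact (Finset.sum_coe_sort (nonzeroEigenvalues L) fun z =>
    Module.finrank ℂ (p ⊓ genEigSpace z L : Submodule ℂ (Fin n → ℂ))).symm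

theorem ne_zero_of_nonzeroEigenvalues {n : ℕ} {A : Matrix (Fin n) (Fin n) ℂ}
    (z : nonzeroEigenvalues A) : (z : ℂ) ≠ 0 :=
  ((mem_nonzeroEigenvalues_iff A z).mp z.2).1

theorem genEigSpace_le_iSup_of_zero_eq {n : ℕ} {A L : Matrix (Fin n) (Fin n) ℂ} (hc : Commute L A)
    (h0 : genEigSpace 0 A = genEigSpace 0 L) (lam : nonzeroEigenvalues A) :
    genEigSpace (lam : ℂ) A ≤
      ⨆ (nu : nonzeroEigenvalues L) (_ : Module.finrank ℂ (genEigSpace (lam : ℂ) A ⊓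
        genEigSpace (nu : ℂ) L : Submodule ℂ (Fin n → ℂ)) ≠ 0), genEigSpace (nu : ℂ) L := by
  have hp := genEigSpace_invariant hc (lam : ℂ)
  conv_lhs => rw [eq_finset_sup_inf_maxGenEigenspace hp (nonzeroEigenvalues L) fun z hz =>
    genEigSpace_inf_eq_bot h0 (ne_zero_of_nonzeroEigenvalues lam) hz]
  refine Finset.sup_le fun z hz => ?_
  by_cases h : genEigSpace (lam : ℂ) A ⊓ genEigSpace z L = ⊥
  · exact h.le.trans bot_le
  · exact inf_le_right.trans (le_iSup₂_of_le (⟨z, hz⟩ : nonzeroEigenvalues L)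
      (fun h' => h (Submodule.finrank_eq_zero.mp h')) le_rfl)

/-- If `algMult ν L` is the dimension of the intersection, then the intersection is all of
`genEigSpace ν L`, which is thus contained in `genEigSpace λ A`. -/
theorem genEigSpace_eq_iSup_of_zero_eq {n : ℕ} {A L : Matrix (Fin n) (Fin n) ℂ} (hc : Commute L A)
    (h0 : genEigSpace 0 A = genEigSpace 0 L) (lam : nonzeroEigenvalues A)
    (h : ∀ nu : nonzeroEigenvalues L, Module.finrank ℂ (genEigSpace (lam : ℂ) A ⊓
      genEigSpace (nu : ℂ) L : Submodule ℂ (Fin n → ℂ)) ≠ 0 → algMult (nu : ℂ) L =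
        Module.finrank ℂ (genEigSpace (lam : ℂ) A ⊓ genEigSpace (nu : ℂ) L :
          Submodule ℂ (Fin n → ℂ))) :
    genEigSpace (lam : ℂ) A =
      ⨆ (nu : nonzeroEigenvalues L) (_ : Module.finrank ℂ (genEigSpace (lam : ℂ) A ⊓
        genEigSpace (nu : ℂ) L : Submodule ℂ (Fin n → ℂ)) ≠ 0), genEigSpace (nu : ℂ) L := by
  refine le_antisymm (genEigSpace_le_iSup_of_zero_eq hc h0 lam) (iSup₂_le fun nu hnu => ?_)
  rw [← Submodule.eq_of_le_of_finrank_eq (inf_le_right : genEigSpace (lam : ℂ) A ⊓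
    genEigSpace (nu : ℂ) L ≤ _) (by rw [finrank_genEigSpace, h nu hnu])]
  exact inf_le_left

/-! ### Jordan bases -/

/-- `b` is a Jordan basis for `f` with blocks of sizes `m i` and eigenvalues `e i`: for every `i`, the
vectors `b ⟨i, j⟩` span an invariant subspace on which the matrix of `f` is `jordanBlock (m i) (e i)`.
The condition is stated vector by vector, so that blocks may be reindexed without casts. Blocks of
size zero are allowed. -/
def IsJordanBasis {V : Type*} [AddCommGroup V] [Module ℂ V] (f : Module.End ℂ V) {ι : Type*}
    {m : ι → ℕ} (e : ι → ℂ) (b : Module.Basis ((i : ι) × Fin (m i)) ℂ V) : Prop :=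
  ∀ i j, f (b ⟨i, j⟩) = ∑ j', jordanBlock (m i) (e i) j' j • b ⟨i, j'⟩

section
open Polynomial

/-- The descending powers of `X - z` are linearly independent modulo `(X - z) ^ m`. They are listed in
descending order so that multiplication by `X` is an upper triangular Jordan block. -/
theorem linearIndependent_pow_X_sub_C (z : ℂ) (m : ℕ) :
    LinearIndependent ℂ fun j : Fin m =>
      (Ideal.Quotient.mk (Ideal.span {(X - C z : ℂ[X]) ^ m}) ((X - C z) ^ (m - 1 - (j : ℕ)))) := by
  rw [Fintype.linearIndependent_iff]
  intro g hg i
  -- the polynomial whose coefficients are the `g j`, in reversed order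
  set q : ℂ[X] := ∑ j : Fin m, C (g j) * X ^ (m - 1 - (j : ℕ)) with hq
  have hcomp : q.comp (X - C z) = ∑ j : Fin m, g j • (X - C z) ^ (m - 1 - (j : ℕ)) := by
    rw [hq, ← Polynomial.coe_compRingHom_apply, map_sum]
    simp [smul_eq_C_mul]
  have hdvd : (X - C z) ^ m ∣ q.comp (X - C z) := by
    rw [← Ideal.mem_span_singleton, ← Ideal.Quotient.eq_zero_iff_mem, hcomp, ← hg, map_sum]
    rfl
  have hdeg : q.degree < m := by
    refine (Polynomial.degree_sum_le _ _).trans_lt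
      ((Finset.sup_lt_iff (WithBot.bot_lt_coe m)).mpr fun j _ => ?_)
    refine (Polynomial.degree_C_mul_X_pow_le _ _).trans_lt ?_
    have := j.2
    exact WithBot.coe_lt_coe.mpr (Nat.cast_lt.mpr (by omega))
  have hq0 : q = 0 := by
    have h1 : q.comp (X - C z) = 0 := by
      refine Polynomial.eq_zero_of_dvd_of_degree_lt hdvd ?_
      rw [Polynomial.degree_pow, Polynomial.degree_X_sub_C, nsmul_one]
      by_cases h0 : q = 0
      · rw [h0, Polynomial.zero_comp, Polynomial.degree_zero]
        exact WithBot.bot_lt_coe m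
      · rw [Polynomial.degree_eq_natDegree h0] at hdeg
        refine Polynomial.degree_le_natDegree.trans_lt ?_
        rw [Polynomial.natDegree_comp, Polynomial.natDegree_X_sub_C, mul_one]
        exact hdeg
    have h2 := congrArg (fun r : ℂ[X] => r.comp (X + C z)) h1
    simpa [Polynomial.comp_assoc] using h2
  have hcoeff := congrArg (fun r : ℂ[X] => r.coeff (m - 1 - (i : ℕ))) hq0
  simp only [hq, Polynomial.finsetSum_coeff, Polynomial.coeff_C_mul, Polynomial.coeff_X_pow,
    Polynomial.coeff_zero] at hcoeff
  rw [Finset.sum_eq_single i] at hcoeff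
  · simpa using hcoeff
  · intro j _ hj
    have h1 := i.2
    have h2 := j.2
    have h3 : (j : ℕ) ≠ i := fun h => hj (Fin.ext h)
    rw [if_neg (by omega), mul_zero]
  · simp

/-- Multiplication by `X` on `ℂ[X] ⧸ (X - z) ^ m` is a single Jordan block. -/
theorem exists_basis_quotient_X_sub_C_pow (z : ℂ) (m : ℕ) :
    ∃ b : Module.Basis (Fin m) ℂ (ℂ[X] ⧸ Ideal.span {(X - C z : ℂ[X]) ^ m}),
      ∀ j, (X : ℂ[X]) • b j = ∑ j', jordanBlock m z j' j • b j' := by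
  have hfin : Module.finrank ℂ (ℂ[X] ⧸ Ideal.span {(X - C z : ℂ[X]) ^ m}) = m := by
    rw [finrank_quotient_span_eq_natDegree, Polynomial.natDegree_pow, Polynomial.natDegree_X_sub_C,
      mul_one]
  have hli := linearIndependent_pow_X_sub_C z m
  rcases Nat.eq_zero_or_pos m with rfl | hm
  · have : Subsingleton (ℂ[X] ⧸ Ideal.span {(X - C z : ℂ[X]) ^ 0}) := by
      rw [pow_zero, Ideal.span_singleton_one]
      infer_instance
    exact ⟨Module.Basis.empty _, fun j => j.elim0⟩
  have : Nonempty (Fin m) := ⟨⟨0, hm⟩⟩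
  refine ⟨basisOfLinearIndependentOfCardEqFinrank hli (by simp [hfin]), fun j => ?_⟩
  simp only [coe_basisOfLinearIndependentOfCardEqFinrank]
  have hX : ∀ r : ℂ[X], (X : ℂ[X]) • Ideal.Quotient.mk (Ideal.span {(X - C z : ℂ[X]) ^ m}) r =
      Ideal.Quotient.mk _ ((X - C z) * r) + z • Ideal.Quotient.mk _ r := by
    intro r
    have : X * r = (X - C z) * r + z • r := by rw [smul_eq_C_mul]; ring
    change Ideal.Quotient.mk _ (X * r) = _
    rw [this, map_add]
    rfl
  rw [hX, ← pow_succ']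
  rcases Nat.eq_zero_or_pos (j : ℕ) with hj | hj
  · rw [Finset.sum_eq_single j]
    · have h1 : m - 1 - (j : ℕ) + 1 = m := by omega
      rw [h1, Ideal.Quotient.eq_zero_iff_mem.mpr (Ideal.mem_span_singleton_self _), zero_add]
      simp [jordanBlock]
    · intro j' _ hj'
      have : (j' : ℕ) + 1 ≠ j := by omega
      simp [jordanBlock, hj', this]
    · simp
  · set i : Fin m := ⟨(j : ℕ) - 1, by omega⟩ with hi
    have hij : i ≠ j := by intro h; have := congrArg Fin.val h; simp [hi] at this; omega
    have hij' : (i : ℕ) + 1 = j := by simp [hi]; omega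
    rw [Finset.sum_eq_add i j hij]
    · have h1 : m - 1 - (j : ℕ) + 1 = m - 1 - (i : ℕ) := by have := j.2; omega
      simp [jordanBlock, hij, hij', h1]
    · rintro j' _ ⟨h1, h2⟩
      have : (j' : ℕ) + 1 ≠ j := fun h => h1 (Fin.ext (by omega))
      simp [jordanBlock, h2, this]
    · simp
    · simp

theorem exists_eq_span_X_sub_C_pow {p : ℂ[X]} (hp : Irreducible p) (m : ℕ) :
    ∃ z : ℂ, Ideal.span {p ^ m} = Ideal.span {(X - C z : ℂ[X]) ^ m} := by
  obtain ⟨z, hz⟩ := IsAlgClosed.exists_root p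
    (IsAlgClosed.degree_eq_one_of_irreducible ℂ hp ▸ one_ne_zero)
  refine ⟨z, Ideal.span_singleton_eq_span_singleton.mpr (Associated.pow_pow ?_)⟩
  exact ((irreducible_X_sub_C z).associated_of_dvd hp (dvd_iff_isRoot.mpr hz)).symm

variable {V : Type*} [AddCommGroup V] [Module ℂ V]

/-- The Jordan normal form: `V` with `X` acting as `f` is a finitely generated torsion module over the
principal ideal domain `ℂ[X]`, hence a direct sum of modules `ℂ[X] ⧸ (X - z) ^ m`. -/
theorem exists_isJordanBasis_of_fintype [FiniteDimensional ℂ V] (f : Module.End ℂ V) :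
    ∃ (ι : Type) (_ : Fintype ι) (m : ι → ℕ) (e : ι → ℂ)
      (b : Module.Basis ((i : ι) × Fin (m i)) ℂ V), IsJordanBasis f e b := by
  classical
  have : Module.Finite ℂ[X] (Module.AEval' f) := inferInstance
  obtain ⟨ι, hι, p, hp, m, ⟨φ⟩⟩ := Module.equiv_directSum_of_isTorsion
    (Module.AEval.isTorsion_of_finiteDimensional ℂ V f)
  choose z hz using fun i => exists_eq_span_X_sub_C_pow (hp i) (m i)
  have hbase : ∀ i, ∃ b : Module.Basis (Fin (m i)) ℂ (ℂ[X] ⧸ Ideal.span {p i ^ m i}),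
      ∀ j, (X : ℂ[X]) • b j = ∑ j', jordanBlock (m i) (z i) j' j • b j' := by
    intro i
    rw [hz i]
    exact exists_basis_quotient_X_sub_C_pow (z i) (m i)
  choose b hb using hbase
  let ψ : V ≃ₗ[ℂ] (i : ι) → ℂ[X] ⧸ Ideal.span {p i ^ m i} :=
    (Module.AEval'.of f).trans
      ((φ.trans (DirectSum.linearEquivFunOnFintype ℂ[X] ι _)).restrictScalars ℂ)
  have hψ : ∀ v, ψ (f v) = (X : ℂ[X]) • ψ v := by
    intro v
    change (φ.trans (DirectSum.linearEquivFunOnFintype ℂ[X] ι _)) (Module.AEval'.of f (f v)) =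
      X • (φ.trans (DirectSum.linearEquivFunOnFintype ℂ[X] ι _)) (Module.AEval'.of f v)
    rw [← map_smul, Module.AEval'.X_smul_of]
  refine ⟨ι, hι, m, z, (Pi.basis b).map ψ.symm, fun i j => ?_⟩
  apply ψ.injective
  rw [hψ]
  simp only [Module.Basis.map_apply, LinearEquiv.apply_symm_apply, map_sum, map_smul,
    Pi.basis_apply]
  rw [← Pi.single_smul, hb]
  simp only [← Pi.single_smul]
  exact map_sum (AddMonoidHom.single _ i) _ _
end

/-! ### Kernel dimensions determine the block sizes -/

section JordanDim
open Module
variable {V : Type*} [AddCommGroup V] [Module ℂ V]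

/-- Blocks of size zero can be dropped, and the remaining ones numbered. -/
theorem exists_isJordanBasis [FiniteDimensional ℂ V] (f : End ℂ V) :
    ∃ (k : ℕ) (m : Fin k → ℕ) (e : Fin k → ℂ) (b : Basis ((i : Fin k) × Fin (m i)) ℂ V),
      (∀ i, 0 < m i) ∧ IsJordanBasis f e b := by
  classical
  obtain ⟨ι, hι, m, e, b, hb⟩ := exists_isJordanBasis_of_fintype f
  let σ := (Fintype.equivFin {i : ι // 0 < m i}).symm
  have hτ : Function.Bijective fun x : (i : Fin _) × Fin (m (σ i)) =>
      (⟨σ x.1, x.2⟩ : (i : ι) × Fin (m i)) := by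
    constructor
    · rintro ⟨i, j⟩ ⟨i', j'⟩ h
      obtain ⟨h1, h2⟩ := Sigma.mk.inj_iff.mp h
      obtain rfl : i = i' := σ.injective (Subtype.ext h1)
      exact congrArg _ (eq_of_heq h2)
    · rintro ⟨i, j⟩
      obtain ⟨i', hi'⟩ := σ.surjective ⟨i, j.pos⟩
      obtain rfl : (σ i' : ι) = i := by rw [hi']
      exact ⟨⟨i', j⟩, rfl⟩
  refine ⟨_, fun i => m (σ i), fun i => e (σ i), b.reindex (Equiv.ofBijective _ hτ).symm,
    fun i => (σ i).2, fun i j => ?_⟩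
  simp only [Basis.reindex_apply, Equiv.symm_symm, Equiv.ofBijective_apply]
  exact hb (σ i) j

/-- The kernel of an endomorphism that is block diagonal in the coordinates `φ` is the product of the
kernels of the blocks. -/
theorem finrank_ker_eq_sum_of_blocks {k : ℕ} {m : Fin k → ℕ}
    (φ : V ≃ₗ[ℂ] ((i : Fin k) → Fin (m i) → ℂ)) (F : End ℂ V)
    (G : (i : Fin k) → End ℂ (Fin (m i) → ℂ)) (h : ∀ v i, φ (F v) i = G i (φ v i)) :
    finrank ℂ (LinearMap.ker F) = ∑ i, finrank ℂ (LinearMap.ker (G i)) := by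
  rw [← Module.finrank_pi_fintype]
  refine LinearEquiv.finrank_eq
    { toFun := fun v i => ⟨φ v i, ?_⟩
      invFun := fun w => ⟨φ.symm fun i => w i, ?_⟩
      map_add' := ?_
      map_smul' := ?_
      left_inv := ?_
      right_inv := ?_ }
  · rw [LinearMap.mem_ker, ← h, LinearMap.mem_ker.mp v.2, map_zero, Pi.zero_apply]
  · intro v w
    ext i j
    simp
  · intro c v
    ext i j
    simp
  · rw [LinearMap.mem_ker]
    apply φ.injective
    ext i : 1
    rw [h, LinearEquiv.apply_symm_apply, map_zero]
    exact (w i).2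
  · intro v
    ext
    simp
  · intro w
    ext i j
    simp

theorem jordanBlock_sub_smul_one (m : ℕ) (z w : ℂ) :
    jordanBlock m z - w • (1 : Matrix (Fin m) (Fin m) ℂ) = jordanBlock m (z - w) := by
  ext i j
  by_cases h : i = j
  · simp [jordanBlock, h]
  · simp [jordanBlock, h]

theorem jordanBlock_zero_pow_mulVec (m k : ℕ) (v : Fin m → ℂ) (i : Fin m) :
    ((jordanBlock m 0) ^ k).mulVec v i = if h : (i : ℕ) + k < m then v ⟨i + k, h⟩ else 0 := by
  induction k generalizing i with
  | zero => simp
  | succ k ih =>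
    rw [pow_succ', ← Matrix.mulVec_mulVec, Matrix.mulVec, dotProduct]
    by_cases h : (i : ℕ) + 1 < m
    · rw [Finset.sum_eq_single ⟨(i : ℕ) + 1, h⟩]
      · have hne : i ≠ ⟨(i : ℕ) + 1, h⟩ := fun h' => by simpa using congrArg Fin.val h'
        rw [ih]
        simp [jordanBlock, hne, add_assoc, add_comm 1 k]
      · intro j _ hj
        have : (i : ℕ) + 1 ≠ j := fun h' => hj (Fin.ext h'.symm)
        simp [jordanBlock, this]
      · simp
    · rw [dif_neg (by omega)]
      refine Finset.sum_eq_zero fun j _ => ?_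
      have : (i : ℕ) + 1 ≠ j := by omega
      simp [jordanBlock, this]

theorem finrank_ker_jordanBlock_zero_pow (m k : ℕ) :
    finrank ℂ (LinearMap.ker (Matrix.toLin' (jordanBlock m 0) ^ k)) = min m k := by
  -- the kernel consists of the vectors whose coordinates from the `k`-th on vanish
  have hker : LinearMap.ker (Matrix.toLin' (jordanBlock m 0) ^ k) =
      ⨅ i ∈ {i : Fin m | k ≤ (i : ℕ)},
        LinearMap.ker (LinearMap.proj (R := ℂ) (φ := fun _ => ℂ) i) := by
    ext v
    simp only [← Matrix.toLin'_pow, LinearMap.mem_ker, Matrix.toLin'_apply, Submodule.mem_iInf,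
      Set.mem_ofPred_eq, LinearMap.proj_apply]
    constructor
    · intro hv i hi
      have := congrFun hv ⟨(i : ℕ) - k, by omega⟩
      rw [jordanBlock_zero_pow_mulVec, dif_pos (by simp [hi])] at this
      simpa [hi] using this
    · intro hv
      ext i
      rw [jordanBlock_zero_pow_mulVec]
      split_ifs with h
      · exact hv _ (by simp)
      · rfl
  have hd : Disjoint {i : Fin m | (i : ℕ) < k} {i : Fin m | k ≤ (i : ℕ)} :=
    Set.disjoint_left.mpr fun i (h1 : (i : ℕ) < k) (h2 : k ≤ (i : ℕ)) => by omega
  have hu : Set.univ ⊆ {i : Fin m | (i : ℕ) < k} ∪ {i : Fin m | k ≤ (i : ℕ)} :=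
    fun i _ => lt_or_ge (i : ℕ) k
  rw [hker, (LinearMap.iInfKerProjEquiv ℂ (fun _ => ℂ) hd hu).finrank_eq,
    Module.finrank_fintype_fun_eq_card, Fintype.card_subtype]
  simp only [Set.mem_ofPred_eq]
  rw [Fin.card_filter_val_lt]

theorem finrank_ker_jordanBlock_pow (m k : ℕ) (z : ℂ) :
    finrank ℂ (LinearMap.ker (Matrix.toLin' (jordanBlock m z) ^ k)) =
      if z = 0 then min m k else 0 := by
  split_ifs with hz
  · rw [hz, finrank_ker_jordanBlock_zero_pow]
  · have hdet : (jordanBlock m z).det ≠ 0 := by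
      rw [Matrix.det_of_isUpperTriangular]
      · simp [jordanBlock, hz]
      · intro i j hij
        have h1 : i ≠ j := ne_of_gt hij
        have h2 : (i : ℕ) + 1 ≠ j := by
          have : (j : ℕ) < i := hij
          omega
        simp [jordanBlock, h1, h2]
    rw [Submodule.finrank_eq_zero, LinearMap.ker_eq_bot']
    intro v hv
    rw [← Matrix.toLin'_pow, Matrix.toLin'_apply] at hv
    exact Matrix.eq_zero_of_mulVec_eq_zero (by rw [Matrix.det_pow]; exact pow_ne_zero k hdet) hv

theorem IsJordanBasis.finrank_genEigenspace {k : ℕ} {m : Fin k → ℕ} {e : Fin k → ℂ} {f : End ℂ V}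
    {b : Basis ((i : Fin k) × Fin (m i)) ℂ V} (hb : IsJordanBasis f e b) (z : ℂ) (l : ℕ) :
    finrank ℂ (f.genEigenspace z l) = ∑ i with e i = z, min (m i) l := by
  let φ : V ≃ₗ[ℂ] ((i : Fin k) → Fin (m i) → ℂ) :=
    b.equivFun.trans (LinearEquiv.piCurry ℂ fun _ _ => ℂ)
  have hφb : ∀ i j, φ (b ⟨i, j⟩) = Pi.single i (Pi.single j 1) := by
    intro i j
    ext i' j'
    by_cases hi : i' = i
    · subst hi
      by_cases hj : j' = j <;> simp [φ, Sigma.curry, hj]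
    · simp [φ, Sigma.curry, hi]
  have hf : ∀ v i, φ (f v) i = Matrix.toLin' (jordanBlock (m i) (e i)) (φ v i) := by
    intro v i
    suffices h : (LinearMap.proj i).comp (φ.toLinearMap.comp f) =
        (Matrix.toLin' (jordanBlock (m i) (e i))).comp ((LinearMap.proj i).comp φ.toLinearMap) from
      LinearMap.congr_fun h v
    refine b.ext fun ⟨i', j⟩ => ?_
    simp only [LinearMap.comp_apply, LinearEquiv.coe_coe, LinearMap.proj_apply, hb i' j, map_sum,
      map_smul, hφb]
    by_cases hi : i = i'
    · subst hi
      ext j'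
      simp [Pi.single_apply]
    · simp [Pi.single_eq_of_ne hi]
  have hpow : ∀ v i, φ (((f - z • 1) ^ l) v) i =
      (Matrix.toLin' (jordanBlock (m i) (e i - z)) ^ l) (φ v i) := by
    have h1 : ∀ v i, φ ((f - z • 1) v) i = Matrix.toLin' (jordanBlock (m i) (e i - z)) (φ v i) := by
      intro v i
      rw [← jordanBlock_sub_smul_one, LinearMap.sub_apply, map_sub, Pi.sub_apply, hf, map_sub]
      simp
    induction l with
    | zero => simp
    | succ l ih =>
      intro v i
      rw [pow_succ', Module.End.mul_apply, h1, ih, pow_succ', Module.End.mul_apply]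
  rw [Module.End.genEigenspace_nat, finrank_ker_eq_sum_of_blocks φ _ _ hpow, Finset.sum_filter]
  refine Finset.sum_congr rfl fun i _ => ?_
  rw [finrank_ker_jordanBlock_pow]
  simp only [sub_eq_zero]

end JordanDim

/-! ### Multisets with given truncated sums -/

theorem Multiset.sum_map_min_succ (s : Multiset ℕ) (l : ℕ) :
    (s.map fun a => min a (l + 1)).sum = (s.map fun a => min a l).sum + s.countP (l < ·) := by
  induction s using Multiset.induction_on with
  | empty => simp
  | cons a s ih =>
    rw [Multiset.map_cons, Multiset.sum_cons, ih, Multiset.map_cons, Multiset.sum_cons,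
      Multiset.countP_cons]
    split_ifs <;> omega

theorem Multiset.countP_lt_eq_count_add (s : Multiset ℕ) (l : ℕ) :
    s.countP (l < ·) = s.count (l + 1) + s.countP (l + 1 < ·) := by
  induction s using Multiset.induction_on with
  | empty => simp
  | cons a s ih =>
    rw [Multiset.countP_cons, Multiset.countP_cons, Multiset.count_cons, ih]
    split_ifs <;> omega

/-- A multiset of positive numbers is determined by its truncated sums: their second differences are
the multiplicities. -/
theorem Multiset.eq_of_sum_map_min_eq {s t : Multiset ℕ} (hs : ∀ a ∈ s, 0 < a) (ht : ∀ a ∈ t, 0 < a)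
    (h : ∀ l, (s.map fun a => min a l).sum = (t.map fun a => min a l).sum) : s = t := by
  have hcount : ∀ l, s.countP (l < ·) = t.countP (l < ·) := fun l => by
    have h1 := s.sum_map_min_succ l
    have h2 := t.sum_map_min_succ l
    have h3 := h l
    have h4 := h (l + 1)
    omega
  ext a
  rcases a with _ | a
  · rw [Multiset.count_eq_zero_of_notMem fun h0 => (hs 0 h0).ne rfl,
      Multiset.count_eq_zero_of_notMem fun h0 => (ht 0 h0).ne rfl]
  · have h1 := s.countP_lt_eq_count_add a
    have h2 := t.countP_lt_eq_count_add a
    have h3 := hcount a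
    have h4 := hcount (a + 1)
    omega

/-! ### Jordan forms of matrices -/

open Module in
theorem isJordanForm_iff_exists_isJordanBasis {n k : ℕ} {A : Matrix (Fin n) (Fin n) ℂ}
    {m : Fin k → ℕ} {e : Fin k → ℂ} :
    IsJordanForm A m e ↔ (∀ i, 0 < m i) ∧
      ∃ b : Basis ((i : Fin k) × Fin (m i)) ℂ (Fin n → ℂ), IsJordanBasis (Matrix.toLin' A) e b := by
  refine and_congr_right fun _ => ⟨?_, ?_⟩
  · rintro ⟨Z, W, hZW, hWZ, hJ⟩
    -- the Jordan basis consists of the columns of `Z`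
    refine ⟨Basis.ofEquivFun (Matrix.toLin'OfInv hZW hWZ), fun i j => ?_⟩
    have hAZ : A * Z = Z * Matrix.blockDiagonal' fun i => jordanBlock (m i) (e i) := by
      rw [← hJ, Matrix.mul_assoc W, ← Matrix.mul_assoc Z, hZW, Matrix.one_mul]
    have hcol : ∀ x, Basis.ofEquivFun (Matrix.toLin'OfInv hZW hWZ) x = Z.col x := by
      intro x
      rw [Basis.coe_ofEquivFun]
      exact Matrix.mulVec_single_one Z x
    simp only [hcol]
    rw [Matrix.toLin'_apply, ← Matrix.mulVec_single_one Z, Matrix.mulVec_mulVec, hAZ,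
      Matrix.mulVec_single_one]
    ext l
    simp only [Matrix.col_apply, Matrix.mul_apply, Finset.sum_apply, Pi.smul_apply, smul_eq_mul]
    rw [Fintype.sum_sigma, Finset.sum_eq_single i]
    · exact Finset.sum_congr rfl fun j' _ => by rw [Matrix.blockDiagonal'_apply_eq, mul_comm]
    · intro i' _ hi'
      exact Finset.sum_eq_zero fun j' _ => by
        rw [Matrix.blockDiagonal'_apply_ne _ _ _ hi', mul_zero]
    · simp
  · rintro ⟨b, hb⟩
    refine ⟨(Pi.basisFun ℂ (Fin n)).toMatrix b, b.toMatrix (Pi.basisFun ℂ (Fin n)),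
      Basis.toMatrix_mul_toMatrix_flip _ _, Basis.toMatrix_mul_toMatrix_flip _ _, ?_⟩
    have hA : A = LinearMap.toMatrix (Pi.basisFun ℂ (Fin n)) (Pi.basisFun ℂ (Fin n))
        (Matrix.toLin' A) := (LinearMap.toMatrix'_toLin' A).symm
    conv_lhs => rw [hA]
    rw [basis_toMatrix_mul_linearMap_toMatrix_mul_basis_toMatrix]
    ext ⟨i, j⟩ ⟨i', j'⟩
    rw [LinearMap.toMatrix_apply, hb]
    simp only [map_sum, map_smul, Basis.repr_self, Finsupp.finsetSum_apply, Finsupp.smul_apply,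
      smul_eq_mul]
    by_cases hi : i = i'
    · subst hi
      rw [Matrix.blockDiagonal'_apply_eq, Finset.sum_eq_single j]
      · simp
      · intro l _ hl
        simp [hl]
      · simp
    · rw [Matrix.blockDiagonal'_apply_ne _ _ _ hi]
      refine Finset.sum_eq_zero fun l _ => ?_
      rw [Finsupp.single_eq_of_ne (fun h => hi (congrArg Sigma.fst h)), mul_zero]

theorem exists_isJordanBlockSizes {n : ℕ} (z : ℂ) (A : Matrix (Fin n) (Fin n) ℂ) :
    ∃ s : Multiset ℕ, IsJordanBlockSizes z A s := by
  obtain ⟨k, m, e, b, hm, hb⟩ := exists_isJordanBasis (Matrix.toLin' A)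
  exact ⟨_, k, m, e, isJordanForm_iff_exists_isJordanBasis.mpr ⟨hm, b, hb⟩, rfl⟩

theorem IsJordanBlockSizes.pos {n : ℕ} {z : ℂ} {A : Matrix (Fin n) (Fin n) ℂ} {s : Multiset ℕ}
    (h : IsJordanBlockSizes z A s) : ∀ a ∈ s, 0 < a := by
  obtain ⟨k, m, e, ⟨hm, -⟩, rfl⟩ := h
  intro a ha
  obtain ⟨i, -, rfl⟩ := Multiset.mem_map.mp ha
  exact hm i

theorem IsJordanBlockSizes.sum_map_min {n : ℕ} {z : ℂ} {A : Matrix (Fin n) (Fin n) ℂ}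
    {s : Multiset ℕ} (h : IsJordanBlockSizes z A s) (l : ℕ) :
    (s.map fun a => min a l).sum =
      Module.finrank ℂ (Module.End.genEigenspace (Matrix.toLin' A) z l) := by
  obtain ⟨k, m, e, hJ, rfl⟩ := h
  obtain ⟨-, b, hb⟩ := isJordanForm_iff_exists_isJordanBasis.mp hJ
  rw [hb.finrank_genEigenspace, Multiset.map_map]
  rfl

open Module in
/-- The multiset `t` consists of the sizes of the Jordan blocks at `z` of the restriction of `f` to the
invariant subspace `q`. -/
theorem exists_blockSizes_restrict {V : Type*} [AddCommGroup V] [Module ℂ V]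
    [FiniteDimensional ℂ V] (f : End ℂ V) (z : ℂ) {q : Submodule ℂ V} (hq : ∀ x ∈ q, f x ∈ q) :
    ∃ t : Multiset ℕ, (∀ a ∈ t, 0 < a) ∧
      (∀ l : ℕ, (t.map fun a => min a l).sum =
        finrank ℂ (f.genEigenspace z l ⊓ q : Submodule ℂ V)) ∧
      t.sum = finrank ℂ (f.maxGenEigenspace z ⊓ q : Submodule ℂ V) := by
  obtain ⟨k, m, e, b, hm, hb⟩ := exists_isJordanBasis (f.restrict hq)
  have hres : ∀ l : ℕ∞, finrank ℂ (End.genEigenspace (f.restrict hq) z l) =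
      finrank ℂ (f.genEigenspace z l ⊓ q : Submodule ℂ V) := by
    intro l
    rw [inf_comm, Submodule.inf_genEigenspace f q hq]
    exact (LinearEquiv.finrank_eq
      (Submodule.equivMapOfInjective q.subtype q.injective_subtype _))
  have hmin : ∀ l : ℕ, (((Finset.univ.filter fun i => e i = z).val.map m).map
      fun a => min a l).sum = finrank ℂ (f.genEigenspace z l ⊓ q : Submodule ℂ V) := by
    intro l
    rw [← hres, hb.finrank_genEigenspace, Multiset.map_map]
    rfl
  refine ⟨(Finset.univ.filter fun i => e i = z).val.map m, ?_, hmin, ?_⟩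
  · intro a ha
    obtain ⟨i, -, rfl⟩ := Multiset.mem_map.mp ha
    exact hm i
  · -- for large `l`, truncation at `l` does not change `t.sum`, and the generalised eigenspace is maximal
    set l := max (finrank ℂ V) (∑ i, m i)
    have h1 : f.maxGenEigenspace z = f.genEigenspace z (l : ℕ) := by
      rw [End.maxGenEigenspace_eq_genEigenspace_finrank]
      exact (End.genEigenspace_eq_genEigenspace_finrank_of_le f z (le_max_left _ _)).symm
    rw [h1, ← hmin, Multiset.map_map]
    refine congrArg Multiset.sum (Multiset.map_congr rfl fun i _ => ?_)
    exact (min_eq_left ((Finset.single_le_sum (fun _ _ => Nat.zero_le _)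
      (Finset.mem_univ i)).trans (le_max_right _ _))).symm

/-- The block sizes of `A` at `λ` are distributed over the nonzero eigenvalues `ν` of `L`: the share of
`ν` consists of the block sizes of the restriction of `A` to `genEigSpace ν L`. -/
theorem exists_partition_blockSizes {n : ℕ} {A L : Matrix (Fin n) (Fin n) ℂ} (hc : Commute L A)
    (h0 : genEigSpace 0 A = genEigSpace 0 L) {lam : ℂ} (hlam : lam ≠ 0) {s : Multiset ℕ}
    (hs : IsJordanBlockSizes lam A s) :
    ∃ P : nonzeroEigenvalues L → Multiset ℕ, (∑ nu, P nu) = s ∧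
      ∀ nu : nonzeroEigenvalues L, Module.finrank ℂ (genEigSpace lam A ⊓
        genEigSpace (nu : ℂ) L : Submodule ℂ (Fin n → ℂ)) = (P nu).sum := by
  choose P hpos hmin hsum using fun nu : nonzeroEigenvalues L =>
    exists_blockSizes_restrict (Matrix.toLin' A) lam (genEigSpace_invariant hc.symm (nu : ℂ))
  refine ⟨P, ?_, fun nu => (hsum nu).symm⟩
  refine Multiset.eq_of_sum_map_min_eq (fun a ha => ?_) hs.pos fun l => ?_
  · obtain ⟨nu, -, hnu⟩ := Multiset.mem_sum.mp ha
    exact hpos nu a hnu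
  · have hinv : ∀ x ∈ Module.End.genEigenspace (Matrix.toLin' A) lam l,
        Matrix.toLin' L x ∈ Module.End.genEigenspace (Matrix.toLin' A) lam l :=
      Module.End.mapsTo_genEigenspace_of_comm (hc.symm.map Matrix.toLinAlgEquiv') lam l
    rw [hs.sum_map_min, finrank_eq_sum_inf_genEigSpace h0 hlam hinv
      (Module.End.genEigenspace_le_maximal _ _ _), ← Multiset.coe_mapAddMonoidHom,
      ← Multiset.coe_sumAddMonoidHom, map_sum, map_sum]
    exact Finset.sum_congr rfl fun nu _ => hmin nu l

theorem mainTheorem3 (n : ℕ) (A L : Matrix (Fin n) (Fin n) ℂ) (hL : L ∈ limitsOfComplexRoots A) :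
    (∀ lam : nonzeroEigenvalues A,
      (∃ s : Multiset ℕ, IsJordanBlockSizes (lam : ℂ) A s) ∧
      (∀ s : Multiset ℕ, IsJordanBlockSizes (lam : ℂ) A s →
        ∃ P : nonzeroEigenvalues L → Multiset ℕ,
          (∑ nu, P nu) = s ∧ ∀ nu, multRearrangement A L lam nu = (P nu).sum) ∧
      (∑ nu, multRearrangement A L lam nu) = algMult (lam : ℂ) A) ∧
    (∀ nu : nonzeroEigenvalues L,
      (∑ lam, multRearrangement A L lam nu) = algMult (nu : ℂ) L) ∧
    (∀ lam : nonzeroEigenvalues A,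
      genEigSpace (lam : ℂ) A ≤
        (⨆ (nu : nonzeroEigenvalues L) (_ : multRearrangement A L lam nu ≠ 0),
          genEigSpace (nu : ℂ) L) ∧
      ((∀ nu : nonzeroEigenvalues L, multRearrangement A L lam nu ≠ 0 →
          algMult (nu : ℂ) L = multRearrangement A L lam nu) →
        genEigSpace (lam : ℂ) A =
          ⨆ (nu : nonzeroEigenvalues L) (_ : multRearrangement A L lam nu ≠ 0),
            genEigSpace (nu : ℂ) L)) ∧
    (∀ nu : nonzeroEigenvalues L,
      genEigSpace (nu : ℂ) L ≤
        (⨆ (lam : nonzeroEigenvalues A) (_ : multRearrangement A L lam nu ≠ 0),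
          genEigSpace (lam : ℂ) A) ∧
      ((∀ lam : nonzeroEigenvalues A, multRearrangement A L lam nu ≠ 0 →
          algMult (lam : ℂ) A = multRearrangement A L lam nu) →
        genEigSpace (nu : ℂ) L =
          ⨆ (lam : nonzeroEigenvalues A) (_ : multRearrangement A L lam nu ≠ 0),
            genEigSpace (lam : ℂ) A)) := by
  have hc := commute_of_mem_limitsOfComplexRoots hL
  have h0 := genEigSpace_zero_of_mem_limitsOfComplexRoots hL
  -- the column statements are the row statements with the roles of `A` and `L` exchanged
  have hswap : ∀ lam nu, multRearrangement A L lam nu = Module.finrank ℂ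
      (genEigSpace (nu : ℂ) L ⊓ genEigSpace (lam : ℂ) A : Submodule ℂ (Fin n → ℂ)) :=
    fun lam nu => by rw [inf_comm]; rfl
  refine ⟨fun lam => ⟨exists_isJordanBlockSizes _ A, fun s hs =>
    exists_partition_blockSizes hc h0 (ne_zero_of_nonzeroEigenvalues lam) hs, ?_⟩, fun nu => ?_,
    fun lam => ⟨genEigSpace_le_iSup_of_zero_eq hc h0 lam,
      genEigSpace_eq_iSup_of_zero_eq hc h0 lam⟩, fun nu => ?_⟩
  · rw [← finrank_genEigSpace]
    exact (finrank_eq_sum_inf_genEigSpace h0 (ne_zero_of_nonzeroEigenvalues lam)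
      (genEigSpace_invariant hc _) le_rfl).symm
  · simp only [hswap]
    rw [← finrank_genEigSpace]
    exact (finrank_eq_sum_inf_genEigSpace h0.symm (ne_zero_of_nonzeroEigenvalues nu)
      (genEigSpace_invariant hc.symm _) le_rfl).symm
  · simp only [hswap]
    exact ⟨genEigSpace_le_iSup_of_zero_eq hc.symm h0.symm nu,
      genEigSpace_eq_iSup_of_zero_eq hc.symm h0.symm nu⟩
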